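/- \textbf{Theorem (Lower bound).} Let $\Sigma=\{a,b,c\}$ and let $P\colon\{a,b,c\}^*\to\{a,b\}^*$ be the natural projection, which erases every $c$ and keeps $a$ and $b$. Here a DFA has a finite nonempty set of states, at most one initial state, a partial transition function, and a set of marked states; it is minimal if no DFA with fewer states marks (accepts) the same language, and the state complexity of a regular language is the number of states of a minimal DFA marking it. For a prefix-closed language $M\subseteq\Sigma^*$, say that $M$ is observable with respect to $\Sigma^*$ and $P$ if for all $s,t\in M$ with $P(s)=P(t)$ and all $x\in\Sigma$, $sx\in M$ implies $tx\in M$. For $K\subseteq\Sigma^*$, let $\overline{\inf}\,\mathrm{O}(K,\Sigma^*,P)$ be the least prefix-closed language that contains $K$ and is observable with respect to $\Sigma^*$ and $P$ (it exists, as the intersection of all such languages). For every $n\ge 2$ there exists a minimal DFA with $n$ states marking a language $K_n\subseteq\{a,b,c\}^*$ such that $\overline{\inf}\,\mathrm{O}(K_n,\Sigma^*,P)$ is regular and its state complexity is at least $\frac34\cdot 2^n-1$. -/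

import Mathlib

namespace SupervisoryControl

/-- The three-letter alphabet `{a, b, c}`. -/
inductive Letter where
  | a : Letter
  | b : Letter
  | c : Letter

/-- A nondeterministic automaton is an (incomplete) deterministic one if it has at most one initial
state and at most one transition from every state under every letter. (Mathlib's `NFA` has no
empty-word transitions.) -/
def IsDFA {α σ : Type*} (A : NFA α σ) : Prop :=
  A.start.Subsingleton ∧ ∀ q x, (A.step q x).Subsingleton

/-- The language `L` is marked by some (incomplete) DFA with exactly `m` states, where the set of
states is finite and nonempty. -/
def MarkedByDFAWithStates {α : Type*} (L : Language α) (m : ℕ) : Prop :=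
  0 < m ∧ ∃ A : NFA α (Fin m), IsDFA A ∧ A.accepts = L

/-- The state complexity of `L` is `m`: the language `L` is marked by some DFA, and `m` is the least
number of states of a DFA marking `L`, that is, the number of states of the minimal DFA. -/
def HasStateComplexity {α : Type*} (L : Language α) (m : ℕ) : Prop :=
  IsLeast {k : ℕ | MarkedByDFAWithStates L k} m

/-- An automaton with states `Fin n` is a minimal DFA: it is a DFA, and no DFA with fewer states
marks the same language. -/
def IsMinimalDFA {α : Type*} {n : ℕ} (A : NFA α (Fin n)) : Prop :=
  IsDFA A ∧ HasStateComplexity A.accepts n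

/-- The prefix closure of a language. -/
def prefixClosure {α : Type*} (L : Language α) : Language α :=
  {w : List α | ∃ u : List α, w ++ u ∈ L}

/-- A language is prefix-closed if it equals its prefix closure. -/
def IsPrefixClosed {α : Type*} (L : Language α) : Prop :=
  L = prefixClosure L

/-- An observation mask maps every event to an event or to the empty word (`none`). -/
abbrev Mask (α β : Type*) := α → Option β

/-- The extension of a mask to words, a monoid homomorphism. -/
def Mask.onWord {α β : Type*} (P : Mask α β) (w : List α) : List β :=
  w.filterMap P

open Classical in
/-- The natural projection from words over `α` to words over the subalphabet `Δ`: it keeps the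
letters of `Δ` and erases all others. -/
noncomputable def naturalProjection {α : Type*} (Δ : Set α) : Mask α Δ :=
  fun x => if h : x ∈ Δ then some ⟨x, h⟩ else none

/-- Observability of a language `K` with respect to the language `G` and the mask `P`: two words of
the prefix closure of `K` that look alike agree on which one-letter continuations within `G` stay
in the prefix closure of `K`. -/
def IsObservable {α β : Type*} (G : Language α) (P : Mask α β) (K : Language α) : Prop :=
  ∀ (s t : List α) (x : α), s ∈ prefixClosure K → t ∈ prefixClosure K →
    P.onWord s = P.onWord t →
    s ++ [x] ∈ prefixClosure K → t ++ [x] ∈ G → t ++ [x] ∈ prefixClosure K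

/-- The prefix-closed superlanguages of `K` that are observable with respect to `G` and `P`. -/
def prefixClosedObservableSuperlanguages {α β : Type*} (K G : Language α) (P : Mask α β) :
    Set (Language α) :=
  {M | K ≤ M ∧ IsPrefixClosed M ∧ IsObservable G P M}

/-- The infimal prefix-closed and observable superlanguage of `K` with respect to `G` and `P`. -/
def infO {α β : Type*} (K G : Language α) (P : Mask α β) : Language α :=
  sInf (prefixClosedObservableSuperlanguages K G P)

theorem mem_infO {α β : Type*} {K G : Language α} {P : Mask α β} {w : List α} :
    w ∈ infO K G P ↔ ∀ M ∈ prefixClosedObservableSuperlanguages K G P, w ∈ M :=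
  Set.mem_sInter

theorem prefixClosure_infO {α β : Type*} (K G : Language α) (P : Mask α β) :
    prefixClosure (infO K G P) = infO K G P := by
  apply le_antisymm
  · rintro w ⟨u, hu⟩
    refine mem_infO.2 fun M hM => ?_
    rw [hM.2.1]
    exact ⟨u, mem_infO.1 hu M hM⟩
  · intro w hw
    exact ⟨[], by rwa [List.append_nil]⟩

/-- The infimal superlanguage is itself prefix-closed, observable and a superlanguage of `K`; it is
thus the least such language. -/
theorem isLeast_infO {α β : Type*} (K G : Language α) (P : Mask α β) :
    IsLeast (prefixClosedObservableSuperlanguages K G P) (infO K G P) := by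
  refine ⟨⟨le_sInf fun M hM => hM.1, (prefixClosure_infO K G P).symm, ?_⟩,
    fun M hM => sInf_le hM⟩
  intro s t x hs ht hP hsx htx
  rw [prefixClosure_infO] at hs ht hsx ⊢
  refine mem_infO.2 fun M hM => ?_
  have h := hM.2.2 s t x
  rw [← hM.2.1] at h
  exact h (mem_infO.1 hs M hM) (mem_infO.1 ht M hM) hP (mem_infO.1 hsx M hM) htx

end SupervisoryControl

namespace SupervisoryControl

/-! In a prefix-closed observable language, words that look alike have the same one-letter
continuations. If every state of `A` is marked, the least such language over `A.accepts` is
therefore read off from the set of states that `A` can reach by words with a given projection. It is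
marked by the `observer`, where `c` does not change this estimate and is only enabled or not
(`infO_eq_observer_accepts`). For `witness`, every set `T` with `0 ∈ T → last ∈ T` is reached
(`exists_observer_eval_eq`), and distinct sets are separated by words (`exists_observer_test_word`).
With `n = k + 2`, exactly `2 ^ k` sets violate the condition, so at least `4 * 2 ^ k - 2 ^ k - 1`
nonempty ones remain, and each costs a state (`card_le_of_markedByDFAWithStates`). -/

/-- The observer of an automaton under the projection erasing `c`: the subset construction closed
under `c`-transitions, where `c` itself labels a self-loop at the sets that have a `c`-successor. -/
def observer {σ : Type*} (A : NFA Letter σ) : DFA Letter (Set σ) where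
  step S x := match x with
    | .a => A.stepSet S .a ∪ A.stepSet (A.stepSet S .a) .c
    | .b => A.stepSet S .b ∪ A.stepSet (A.stepSet S .b) .c
    | .c => {q ∈ S | (A.stepSet S .c).Nonempty}
  start := A.start ∪ A.stepSet A.start .c
  accept := {S | S.Nonempty}

/-- The projection that erases `c`. -/
noncomputable abbrev eraseC : Mask Letter ({Letter.a, Letter.b} : Set Letter) :=
  naturalProjection {Letter.a, Letter.b}

theorem stepSet_mono {α σ : Type*} (A : NFA α σ) {S T : Set σ} (h : S ⊆ T) (x : α) :
    A.stepSet S x ⊆ A.stepSet T x :=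
  Set.biUnion_subset_biUnion_left h

theorem onWord_append {α β : Type*} (P : Mask α β) (u v : List α) :
    P.onWord (u ++ v) = P.onWord u ++ P.onWord v :=
  List.filterMap_append

theorem onWord_eraseC_append_c (w : List Letter) :
    eraseC.onWord (w ++ [Letter.c]) = eraseC.onWord w := by
  rw [onWord_append]
  simp [Mask.onWord, naturalProjection]

theorem onWord_singleton_of_mem {α : Type*} {Δ : Set α} {x : α} (hx : x ∈ Δ) :
    (naturalProjection Δ).onWord [x] = [⟨x, hx⟩] := by
  simp [Mask.onWord, naturalProjection, hx]

/-! ### The observer and the infimal superlanguage -/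

section Observer

variable {σ : Type*} (A : NFA Letter σ)

theorem observer_step_c_of_nonempty {S : Set σ} (h : ((observer A).step S .c).Nonempty) :
    (observer A).step S .c = S := by
  obtain ⟨q, -, h⟩ := h
  exact Set.ext fun q => ⟨fun hq => hq.1, fun hq => ⟨hq, h⟩⟩

theorem stepSet_nonempty_of_observer_step {S : Set σ} {x : Letter}
    (h : ((observer A).step S x).Nonempty) : (A.stepSet S x).Nonempty := by
  cases x with
  | c => exact h.choose_spec.2
  | _ =>
    rw [Set.nonempty_iff_ne_empty] at h ⊢
    intro h0
    exact h (by simp [observer, h0])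

theorem nonempty_of_observer_step {S : Set σ} {x : Letter}
    (h : ((observer A).step S x).Nonempty) : S.Nonempty := by
  obtain ⟨q, hq⟩ := stepSet_nonempty_of_observer_step A h
  obtain ⟨r, hr, -⟩ := NFA.mem_stepSet.1 hq
  exact ⟨r, hr⟩

theorem nonempty_of_observer_evalFrom {S : Set σ} {u : List Letter}
    (h : ((observer A).evalFrom S u).Nonempty) : S.Nonempty := by
  induction u generalizing S with
  | nil => exact h
  | cons x u ih => exact nonempty_of_observer_step A (ih h)

/-- A nonempty value of the observer depends only on the projection of the word read. -/
theorem observer_eval_eq_foldl {w : List Letter} (h : ((observer A).eval w).Nonempty) :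
    (observer A).eval w =
      (eraseC.onWord w).foldl (fun S x => (observer A).step S x.1) (observer A).start := by
  induction w using List.reverseRecOn with
  | nil => rfl
  | append_singleton w x ih =>
    rw [DFA.eval_append_singleton] at h ⊢
    have ih := ih (nonempty_of_observer_step A h)
    by_cases hx : x ∈ ({Letter.a, Letter.b} : Set Letter)
    · rw [onWord_append, onWord_singleton_of_mem hx, List.foldl_append, ← ih]
      rfl
    · obtain rfl : x = .c := by cases x <;> simp_all
      rw [onWord_eraseC_append_c, observer_step_c_of_nonempty A h, ih]

theorem prefixClosure_observer_accepts :
    prefixClosure (observer A).accepts = (observer A).accepts := by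
  apply le_antisymm
  · rintro w ⟨u, hu⟩
    have hu' : ((observer A).evalFrom (observer A).start (w ++ u)).Nonempty := hu
    rw [DFA.evalFrom_of_append] at hu'
    exact nonempty_of_observer_evalFrom A hu'
  · intro w hw
    exact ⟨[], by rwa [List.append_nil]⟩

theorem isObservable_observer_accepts (G : Language Letter) :
    IsObservable G eraseC (observer A).accepts := by
  intro s t x hs ht hP hsx _
  rw [prefixClosure_observer_accepts] at hs ht hsx ⊢
  -- Both values are nonempty, hence determined by the common projection.
  have hst : (observer A).eval s = (observer A).eval t := by
    rw [observer_eval_eq_foldl A hs, observer_eval_eq_foldl A ht, hP]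
  rw [DFA.mem_accepts, DFA.eval_append_singleton] at hsx ⊢
  rwa [← hst]

/-- By `hA`, a second `c` reaches nothing new, so the single `c`-step built into the observer
already gives the full closure. -/
theorem stepSet_observer_eval_subset
    (hA : ∀ S, A.stepSet (A.stepSet S .c) .c ⊆ A.stepSet S .c) (w : List Letter) :
    A.stepSet ((observer A).eval w) .c ⊆ (observer A).eval w := by
  have key : ∀ S, A.stepSet (S ∪ A.stepSet S .c) .c ⊆ S ∪ A.stepSet S .c := fun S => by
    rw [NFA.stepSet_union]
    exact Set.union_subset Set.subset_union_right ((hA S).trans Set.subset_union_right)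
  induction w using List.reverseRecOn with
  | nil => exact key _
  | append_singleton w x ih =>
    rw [DFA.eval_append_singleton]
    cases x with
    | c =>
      rintro q hq
      have hne : ((observer A).step ((observer A).eval w) .c).Nonempty := by
        obtain ⟨r, hr, -⟩ := NFA.mem_stepSet.1 hq
        exact ⟨r, hr⟩
      rw [observer_step_c_of_nonempty A hne] at hq ⊢
      exact ih hq
    | _ => exact key _

theorem eval_subset_observer_eval
    (hA : ∀ S, A.stepSet (A.stepSet S .c) .c ⊆ A.stepSet S .c) (w : List Letter) : A.eval w ⊆ (observer A).eval w := by
  induction w using List.reverseRecOn with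
  | nil => exact Set.subset_union_left
  | append_singleton w x ih =>
    rw [DFA.eval_append_singleton, NFA.eval_append_singleton]
    have h := stepSet_mono A ih x
    cases x with
    | c => exact fun q hq => ⟨stepSet_observer_eval_subset A hA w (h hq), q, h hq⟩
    | _ => exact h.trans Set.subset_union_left

/-- The estimate contains no spurious states: each `c`-step taken silently by the observer can be
inserted into the word as a letter `c`, which the projection erases. -/
theorem exists_eval_of_mem_observer_eval {w : List Letter} {q : σ} (hq : q ∈ (observer A).eval w) :
    ∃ v, eraseC.onWord v = eraseC.onWord w ∧ q ∈ A.eval v := by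
  induction w using List.reverseRecOn generalizing q with
  | nil =>
    rcases hq with hq | hq
    · exact ⟨[], rfl, hq⟩
    · exact ⟨[.c], onWord_eraseC_append_c [], by rwa [NFA.eval_singleton]⟩
  | append_singleton w x ih =>
    rw [DFA.eval_append_singleton] at hq
    have step : ∀ r ∈ A.stepSet ((observer A).eval w) x,
        ∃ v, eraseC.onWord v = eraseC.onWord (w ++ [x]) ∧ r ∈ A.eval v := by
      intro r hr
      obtain ⟨p, hp, hpr⟩ := NFA.mem_stepSet.1 hr
      obtain ⟨v, hv, hpv⟩ := ih hp
      refine ⟨v ++ [x], by rw [onWord_append, onWord_append, hv], ?_⟩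
      rw [NFA.eval_append_singleton]
      exact NFA.mem_stepSet.2 ⟨p, hpv, hpr⟩
    have closed : ∀ r ∈ A.stepSet (A.stepSet ((observer A).eval w) x) .c,
        ∃ v, eraseC.onWord v = eraseC.onWord (w ++ [x]) ∧ r ∈ A.eval v := by
      intro r hr
      obtain ⟨p, hp, hpr⟩ := NFA.mem_stepSet.1 hr
      obtain ⟨v, hv, hpv⟩ := step p hp
      refine ⟨v ++ [.c], by rw [onWord_eraseC_append_c, hv], ?_⟩
      rw [NFA.eval_append_singleton]
      exact NFA.mem_stepSet.2 ⟨p, hpv, hpr⟩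
    cases x with
    | c =>
      rw [onWord_eraseC_append_c]
      exact ih hq.1
    | _ => exact hq.elim (step q) (closed q)

/-- The observer marks the infimal prefix-closed observable superlanguage. -/
theorem infO_eq_observer_accepts
    (hA : ∀ S, A.stepSet (A.stepSet S .c) .c ⊆ A.stepSet S .c) (hacc : A.accept = Set.univ) :
    infO A.accepts ⊤ eraseC = (observer A).accepts := by
  apply le_antisymm
  · refine sInf_le ⟨?_, (prefixClosure_observer_accepts A).symm,
      isObservable_observer_accepts A ⊤⟩
    rintro w ⟨q, -, hq⟩
    exact ⟨q, eval_subset_observer_eval A hA w hq⟩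
  · refine fun w hw => mem_infO.2 ?_
    rintro L ⟨hKL, hpre, hobs⟩
    have memL : ∀ {v q}, q ∈ A.eval v → v ∈ L := fun {v q} hq =>
      hKL ⟨q, hacc ▸ Set.mem_univ q, hq⟩
    induction w using List.reverseRecOn with
    | nil =>
      obtain ⟨q, hq⟩ := id hw
      obtain ⟨v, -, hqv⟩ := exists_eval_of_mem_observer_eval A hq
      rw [hpre]
      exact ⟨v, memL hqv⟩
    | append_singleton w x ih =>
      have hne : ((observer A).step ((observer A).eval w) x).Nonempty := by
        rw [← DFA.eval_append_singleton]
        exact hw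
      have hwL := ih (nonempty_of_observer_step A hne)
      obtain ⟨r, hr⟩ := stepSet_nonempty_of_observer_step A hne
      obtain ⟨q, hq, hqr⟩ := NFA.mem_stepSet.1 hr
      obtain ⟨v, hvw, hqv⟩ := exists_eval_of_mem_observer_eval A hq
      have hvx : v ++ [x] ∈ L := memL (q := r) (by
        rw [NFA.eval_append_singleton]
        exact NFA.mem_stepSet.2 ⟨q, hqv, hqr⟩)
      -- `v` looks like `w` and can be continued by `x` inside `L`, so observability forces `w ++
      -- [x]` into `L`.
      have h := hobs v w x
      rw [← hpre] at h
      exact h (memL hqv) hwL hvw hvx trivial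

end Observer

/-! ### State complexity of partial DFAs -/

section StateComplexity

variable {α : Type*}

/-- Live words that are pairwise separated by some continuation lead to distinct states. -/
theorem card_le_of_markedByDFAWithStates {ι : Type*} [Fintype ι] {L : Language α} (w : ι → List α)
    (hlive : ∀ i, ∃ u, w i ++ u ∈ L)
    (hsep : ∀ i j, (∀ u, w i ++ u ∈ L ↔ w j ++ u ∈ L) → i = j)
    {m : ℕ} (hm : MarkedByDFAWithStates L m) : Fintype.card ι ≤ m := by
  obtain ⟨-, A, ⟨hstart, hstep⟩, rfl⟩ := hm
  have hsub : ∀ v, (A.eval v).Subsingleton := by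
    intro v
    induction v using List.reverseRecOn with
    | nil => exact hstart
    | append_singleton v x ih =>
      rw [NFA.eval_append_singleton]
      intro p hp q hq
      obtain ⟨p', hp', hp⟩ := NFA.mem_stepSet.1 hp
      obtain ⟨q', hq', hq⟩ := NFA.mem_stepSet.1 hq
      obtain rfl := ih hp' hq'
      exact hstep _ _ hp hq
  -- Transitions are partial, so liveness is what guarantees that the run on `w i` exists.
  have hne : ∀ i, (A.eval (w i)).Nonempty := by
    intro i
    obtain ⟨u, q, -, hq⟩ := hlive i
    have hq : q ∈ A.evalFrom A.start (w i ++ u) := hq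
    rw [NFA.evalFrom_append] at hq
    obtain ⟨p, hp, -⟩ := NFA.mem_evalFrom_iff_exists.1 hq
    exact ⟨p, hp⟩
  choose f hf using hne
  have hinj : Function.Injective f := by
    intro i j hij
    have he : A.eval (w i) = A.eval (w j) := by
      rw [(hsub _).eq_singleton_of_mem (hf i), (hsub _).eq_singleton_of_mem (hf j), hij]
    refine hsep i j fun u => ?_
    rw [NFA.accepts_eq_acceptsFrom_start, NFA.append_mem_acceptsFrom, NFA.append_mem_acceptsFrom]
    exact Iff.of_eq (congrArg (fun S => u ∈ A.acceptsFrom S) he)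
  simpa using Fintype.card_le_of_injective f hinj

theorem exists_hasStateComplexity {σ : Type*} [Fintype σ] (D : DFA α σ) :
    ∃ m, HasStateComplexity D.accepts m := by
  have h : {k | MarkedByDFAWithStates D.accepts k}.Nonempty := by
    refine ⟨Fintype.card σ, Fintype.card_pos_iff.2 ⟨D.start⟩,
      (DFA.reindex (Fintype.equivFin σ) D).toNFA, ⟨?_, fun q x => ?_⟩, ?_⟩
    · exact Set.subsingleton_singleton
    · exact Set.subsingleton_singleton
    · rw [DFA.toNFA_correct, DFA.accepts_reindex]
  exact ⟨sInf _, Nat.sInf_mem h, fun k hk => Nat.sInf_le hk⟩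

end StateComplexity

/-! ### The witness automaton and its observer -/

/-- The witness automaton: `a` rotates the states cyclically, `b` does the same but is undefined in
the last state, and `c` leads from the initial state to the last one. -/
def witness (k : ℕ) : NFA Letter (Fin (k + 2)) where
  step q x := match x with
    | .a => {q + 1}
    | .b => {r | q ≠ Fin.last (k + 1) ∧ r = q + 1}
    | .c => {r | q = 0 ∧ r = Fin.last (k + 1)}
  start := {0}
  accept := Set.univ

section Witness

variable {k : ℕ}

theorem isDFA_witness : IsDFA (witness k) := by
  refine ⟨Set.subsingleton_singleton, fun q x => ?_⟩
  cases x with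
  | a => exact Set.subsingleton_singleton
  | b => exact fun r hr s hs => hr.2.trans hs.2.symm
  | c => exact fun r hr s hs => hr.2.trans hs.2.symm

theorem mem_witness_stepSet_a {S : Set (Fin (k + 2))} {q : Fin (k + 2)} :
    q ∈ (witness k).stepSet S .a ↔ q - 1 ∈ S := by
  rw [NFA.mem_stepSet]
  constructor
  · rintro ⟨r, hr, rfl⟩
    rwa [add_sub_cancel_right]
  · exact fun h => ⟨q - 1, h, (sub_add_cancel q 1).symm⟩

theorem zero_sub_one_eq_last : (0 : Fin (k + 2)) - 1 = Fin.last (k + 1) := by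
  rw [sub_eq_iff_eq_add, Fin.last_add_one]

theorem sub_one_eq_last {q : Fin (k + 2)} : q - 1 = Fin.last (k + 1) ↔ q = 0 := by
  rw [← zero_sub_one_eq_last, sub_left_inj]

theorem mem_witness_stepSet_b {S : Set (Fin (k + 2))} {q : Fin (k + 2)} :
    q ∈ (witness k).stepSet S .b ↔ q ≠ 0 ∧ q - 1 ∈ S := by
  rw [NFA.mem_stepSet, ne_eq, ← sub_one_eq_last]
  constructor
  · rintro ⟨r, hr, hl, rfl⟩
    rw [add_sub_cancel_right]
    exact ⟨hl, hr⟩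
  · exact fun h => ⟨q - 1, h.2, h.1, (sub_add_cancel q 1).symm⟩

theorem mem_witness_stepSet_c {S : Set (Fin (k + 2))} {q : Fin (k + 2)} :
    q ∈ (witness k).stepSet S .c ↔ 0 ∈ S ∧ q = Fin.last (k + 1) := by
  rw [NFA.mem_stepSet]
  constructor
  · rintro ⟨r, hr, rfl, hq⟩
    exact ⟨hr, hq⟩
  · exact fun h => ⟨0, h.1, rfl, h.2⟩

theorem zero_ne_last : (0 : Fin (k + 2)) ≠ Fin.last (k + 1) :=
  (Fin.last_pos).ne

theorem witness_stepSet_c_stepSet_c (S : Set (Fin (k + 2))) :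
    (witness k).stepSet ((witness k).stepSet S .c) .c ⊆ (witness k).stepSet S .c := by
  intro q hq
  exact absurd (mem_witness_stepSet_c.1 (mem_witness_stepSet_c.1 hq).1).2 zero_ne_last

theorem mem_observer_step_a {S : Set (Fin (k + 2))} {q : Fin (k + 2)} :
    q ∈ (observer (witness k)).step S .a ↔
      q - 1 ∈ S ∨ Fin.last (k + 1) ∈ S ∧ q = Fin.last (k + 1) := by
  refine (Set.mem_union _ _ _).trans ?_
  rw [mem_witness_stepSet_a, mem_witness_stepSet_c, mem_witness_stepSet_a, zero_sub_one_eq_last]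

theorem mem_observer_step_b {S : Set (Fin (k + 2))} {q : Fin (k + 2)} :
    q ∈ (observer (witness k)).step S .b ↔ q ≠ 0 ∧ q - 1 ∈ S := by
  refine (Set.mem_union _ _ _).trans ?_
  rw [mem_witness_stepSet_b, mem_witness_stepSet_c, mem_witness_stepSet_b]
  simp

theorem observer_step_c_nonempty {S : Set (Fin (k + 2))} :
    ((observer (witness k)).step S .c).Nonempty ↔ 0 ∈ S := by
  constructor
  · intro h
    obtain ⟨q, hq⟩ := stepSet_nonempty_of_observer_step _ h
    exact (mem_witness_stepSet_c.1 hq).1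
  · exact fun h => ⟨0, h, _, mem_witness_stepSet_c.2 ⟨h, rfl⟩⟩

theorem witness_eval_replicate_a (q : Fin (k + 2)) :
    (witness k).eval (List.replicate q.val .a) = {q} := by
  induction q using Fin.induction with
  | zero => rfl
  | succ i ih =>
    rw [Fin.val_succ, List.replicate_succ', NFA.eval_append_singleton]
    rw [Fin.val_castSucc] at ih
    rw [ih, NFA.stepSet_singleton, ← Fin.coeSucc_eq_succ]
    rfl

/-- The witness automaton separates each state from all others by a word. -/
theorem exists_witness_test_word (q : Fin (k + 2)) :
    ∃ u, ∀ S, ((witness k).evalFrom S u).Nonempty ↔ q ∈ S := by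
  induction q using Fin.reverseInduction with
  | last =>
    refine ⟨[.a, .c], fun S => ?_⟩
    rw [← zero_sub_one_eq_last, ← mem_witness_stepSet_a]
    constructor
    · rintro ⟨q, hq⟩
      exact (mem_witness_stepSet_c.1 hq).1
    · exact fun h => ⟨_, mem_witness_stepSet_c.2 ⟨h, rfl⟩⟩
  | cast i ih =>
    obtain ⟨u, hu⟩ := ih
    refine ⟨.b :: u, fun S => ?_⟩
    rw [NFA.evalFrom_cons, hu, mem_witness_stepSet_b, ← Fin.coeSucc_eq_succ, add_sub_cancel_right,
      Fin.coeSucc_eq_succ]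
    simp [Fin.succ_ne_zero]

/-- For every state `q` there is a word that the observer can read exactly from the sets
containing `q`. -/
theorem exists_observer_test_word (q : Fin (k + 2)) :
    ∃ u, ∀ S, ((observer (witness k)).evalFrom S u).Nonempty ↔ q ∈ S := by
  induction q using Fin.reverseInduction with
  | last =>
    -- Only the last state is moved to `0` by `a`, and `c` is enabled only at `0`. Preceding `b`s
    -- shift a smaller state to the last one, while larger states drop out.
    refine ⟨[.a, .c], fun S => ?_⟩
    rw [DFA.evalFrom_cons, DFA.evalFrom_singleton, observer_step_c_nonempty, mem_observer_step_a,
      zero_sub_one_eq_last]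
    simp
  | cast i ih =>
    obtain ⟨u, hu⟩ := ih
    refine ⟨.b :: u, fun S => ?_⟩
    rw [DFA.evalFrom_cons, hu, mem_observer_step_b, ← Fin.coeSucc_eq_succ, add_sub_cancel_right,
      Fin.coeSucc_eq_succ]
    simp [Fin.succ_ne_zero]

/-- Once the last state is in the estimate, `a` moves it to `0` and the silent `c` restores it, so
each `a` enlarges the initial segment by one state. -/
theorem exists_observer_eval_eq_univ : ∃ w, (observer (witness k)).eval w = Set.univ := by
  have h : ∀ j : ℕ, ∃ w, Fin.last (k + 1) ∈ (observer (witness k)).eval w ∧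
      ∀ q : Fin (k + 2), q.val ≤ j → q ∈ (observer (witness k)).eval w := by
    intro j
    induction j with
    | zero =>
      refine ⟨[], Or.inr (mem_witness_stepSet_c.2 ⟨rfl, rfl⟩), fun q hq => Or.inl ?_⟩
      exact Fin.ext (Nat.le_zero.1 hq)
    | succ j ih =>
      obtain ⟨w, hl, hw⟩ := ih
      refine ⟨w ++ [.a], ?_, fun q hq => ?_⟩ <;>
        rw [DFA.eval_append_singleton, mem_observer_step_a]
      · exact Or.inr ⟨hl, rfl⟩
      · induction q using Fin.cases with
        | zero => exact Or.inl (by rwa [zero_sub_one_eq_last])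
        | succ i =>
          left
          rw [← Fin.coeSucc_eq_succ, add_sub_cancel_right]
          exact hw _ (by simpa using hq)
  obtain ⟨w, -, hw⟩ := h (k + 2)
  exact ⟨w, Set.eq_univ_of_forall fun q => hw q q.isLt.le⟩

/-- Every set of states closed under `c` is reached by the observer. -/
theorem exists_observer_eval_eq {T : Set (Fin (k + 2))} (hT : 0 ∈ T → Fin.last (k + 1) ∈ T) :
    ∃ w, (observer (witness k)).eval w = T := by
  have h : ∀ (j : ℕ) (T : Set (Fin (k + 2))), (0 ∈ T → Fin.last (k + 1) ∈ T) →
      (∀ q : Fin (k + 2), j ≤ q.val → q ∈ T) → ∃ w, (observer (witness k)).eval w = T := by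
    intro j
    induction j with
    | zero =>
      intro T _ hj
      rw [Set.eq_univ_of_forall fun q => hj q (Nat.zero_le _)]
      exact exists_observer_eval_eq_univ
    | succ j ih =>
      intro T hT hj
      -- The predecessor is `T` rotated back, with the last state added: `a` carries that state to
      -- `0`, and `b` deletes it. The choice depends on whether `0 ∈ T`.
      obtain ⟨w, hw⟩ := ih {q | q = Fin.last (k + 1) ∨ q + 1 ∈ T} (fun _ => Or.inl rfl) (by
        intro q hq
        induction q using Fin.lastCases with
        | last => exact Or.inl rfl
        | cast i =>
          right
          rw [Fin.coeSucc_eq_succ]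
          exact hj _ (by simpa using hq))
      by_cases h0 : 0 ∈ T
      · refine ⟨w ++ [.a], Set.ext fun q => ?_⟩
        rw [DFA.eval_append_singleton, mem_observer_step_a, hw, Set.mem_ofPred_eq, sub_one_eq_last,
          sub_add_cancel]
        constructor
        · rintro ((rfl | h) | ⟨-, rfl⟩)
          exacts [h0, h, hT h0]
        · exact fun h => Or.inl (Or.inr h)
      · refine ⟨w ++ [.b], Set.ext fun q => ?_⟩
        rw [DFA.eval_append_singleton, mem_observer_step_b, hw, Set.mem_ofPred_eq, sub_one_eq_last,
          sub_add_cancel]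
        constructor
        · exact fun h => h.2.resolve_left h.1
        · exact fun h => ⟨fun hq => h0 (hq ▸ h), Or.inr h⟩
  exact h (k + 2) T hT fun q hq => absurd q.isLt (not_lt.2 hq)

theorem isMinimalDFA_witness : IsMinimalDFA (witness k) := by
  refine ⟨isDFA_witness, ⟨Nat.succ_pos _, witness k, isDFA_witness, rfl⟩, fun m hm => ?_⟩
  have mem_iff : ∀ (q : Fin (k + 2)) (u : List Letter),
      List.replicate q.val .a ++ u ∈ (witness k).accepts ↔
        ((witness k).evalFrom {q} u).Nonempty := by
    intro q u
    rw [NFA.mem_accepts, NFA.evalFrom_append]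
    change (∃ r ∈ Set.univ, r ∈ (witness k).evalFrom ((witness k).eval _) u) ↔ _
    rw [witness_eval_replicate_a]
    simp [Set.Nonempty]
  refine (Fintype.card_fin (k + 2)).symm.trans_le (card_le_of_markedByDFAWithStates
    (fun q : Fin (k + 2) => List.replicate q.val .a) (fun q => ⟨[], ?_⟩) (fun q r h => ?_) hm)
  · exact (mem_iff q []).2 ⟨q, rfl⟩
  · obtain ⟨u, hu⟩ := exists_witness_test_word r
    have h := h u
    rw [mem_iff, mem_iff, hu, hu] at h
    exact (h.2 rfl).symm

open Classical in
theorem card_closed_sets_ge (k : ℕ) :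
    3 * 2 ^ k - 1 ≤ Fintype.card
      {T : Set (Fin (k + 2)) // T.Nonempty ∧ (0 ∈ T → Fin.last (k + 1) ∈ T)} := by
  -- Such a set is determined by its trace on the `k` states strictly between `0` and the last one.
  have hopen : Fintype.card {T : Set (Fin (k + 2)) // 0 ∈ T ∧ Fin.last (k + 1) ∉ T} ≤ 2 ^ k := by
    have hinj : Function.Injective
        fun T : {T : Set (Fin (k + 2)) // 0 ∈ T ∧ Fin.last (k + 1) ∉ T} =>
          {i : Fin k | i.castSucc.succ ∈ T.1} := by
      rintro ⟨S, hS⟩ ⟨T, hT⟩ hST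
      refine Subtype.ext (Set.ext fun q => ?_)
      induction q using Fin.cases with
      | zero => exact iff_of_true hS.1 hT.1
      | succ i =>
        induction i using Fin.lastCases with
        | last => exact iff_of_false hS.2 hT.2
        | cast i => exact Set.ext_iff.1 hST i
    simpa using Fintype.card_le_of_injective _ hinj
  have hcover : Fintype.card (Set (Fin (k + 2))) ≤
      Fintype.card {T : Set (Fin (k + 2)) // T.Nonempty ∧ (0 ∈ T → Fin.last (k + 1) ∈ T)} +
        (Fintype.card {T : Set (Fin (k + 2)) // 0 ∈ T ∧ Fin.last (k + 1) ∉ T} + 1) := by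
    rw [Fintype.card_subtype, Fintype.card_subtype, ← Finset.card_univ]
    refine le_trans (Finset.card_le_card fun T _ => ?_) ((Finset.card_union_le _ _).trans
      (Nat.add_le_add_left ((Finset.card_union_le _ {∅}).trans_eq rfl) _))
    simp only [Finset.mem_union, Finset.mem_filter, Finset.mem_univ, true_and,
      Finset.mem_singleton, Set.nonempty_iff_ne_empty]
    tauto
  rw [Fintype.card_set, Fintype.card_fin, pow_add] at hcover
  omega

end Witness

end SupervisoryControl

theorem mainTheorem2 (n : ℕ) (hn : 2 ≤ n) :
    ∃ A : NFA SupervisoryControl.Letter (Fin n),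
      SupervisoryControl.IsMinimalDFA A ∧
      ∃ m : ℕ,
        SupervisoryControl.HasStateComplexity
          (SupervisoryControl.infO A.accepts ⊤
            (SupervisoryControl.naturalProjection
              {SupervisoryControl.Letter.a, SupervisoryControl.Letter.b})) m ∧
        (3 / 4 : ℝ) * 2 ^ n - 1 ≤ (m : ℝ) := by
  classical
  obtain ⟨k, rfl⟩ := Nat.exists_eq_add_of_le' hn
  refine ⟨SupervisoryControl.witness k, SupervisoryControl.isMinimalDFA_witness, ?_⟩
  rw [SupervisoryControl.infO_eq_observer_accepts _
    SupervisoryControl.witness_stepSet_c_stepSet_c rfl]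
  obtain ⟨m, hm⟩ :=
    SupervisoryControl.exists_hasStateComplexity (SupervisoryControl.observer (SupervisoryControl.witness k))
  refine ⟨m, hm, ?_⟩
  choose w hw using fun T : {T : Set (Fin (k + 2)) //
      T.Nonempty ∧ (0 ∈ T → Fin.last (k + 1) ∈ T)} =>
    SupervisoryControl.exists_observer_eval_eq T.2.2
  have mem_iff : ∀ T u, w T ++ u ∈ (SupervisoryControl.observer
      (SupervisoryControl.witness k)).accepts ↔
      ((SupervisoryControl.observer (SupervisoryControl.witness k)).evalFrom T.1 u).Nonempty := by
    intro T u
    rw [← hw T]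
    exact Iff.of_eq (congrArg Set.Nonempty (DFA.evalFrom_of_append _ _ _ _))
  have hcard := SupervisoryControl.card_le_of_markedByDFAWithStates w
    (fun T => ⟨[], (mem_iff T []).2 T.2.1⟩) (fun S T h => ?_) hm.1
  · have h := (SupervisoryControl.card_closed_sets_ge k).trans hcard
    have h' : 3 * 2 ^ k ≤ m + 1 := by omega
    have h'' : (3 : ℝ) * 2 ^ k ≤ m + 1 := by exact_mod_cast h'
    rw [pow_add]
    linarith
  · refine Subtype.ext (Set.ext fun q => ?_)
    obtain ⟨u, hu⟩ := SupervisoryControl.exists_observer_test_word q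
    rw [← hu S.1, ← hu T.1, ← mem_iff, ← mem_iff]
    exact h u
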